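/- Let $G=(V,E)$ be a finite simple graph that is $3$-connected (i.e. $|V|>3$ and $G$ remains connected after the deletion of any set of fewer than $3$ vertices). Fix an arbitrary reference orientation of $G$, i.e. a tail $e^-$ and a head $e^+$ for each edge $e$. Let $D:\mathbb{R}^E\to\mathbb{R}^V$, $(DF)(v)=\sum_{e:\,e^+=v}F(e)-\sum_{e:\,e^-=v}F(e)$, let $Z(G)=\ker D$ be the cycle space, and let $B(G)=Z(G)^\perp$ be the cut space, the orthogonal complement being taken in $\ell_2(E)$, that is, in $\mathbb{R}^E$ with the standard inner product. Let $\mathrm{Cy}(G)$ be the group of linear isometries of $\ell_1(E)$ (that is, of $\mathbb{R}^E$ with the norm $\|f\|_1=\sum_{e\in E}|f(e)|$) for which $Z(G)$ is an invariant subspace. An *invariant projection* onto $Z(G)$ is a linear projection $P$ of $\ell_2(E)$ onto $Z(G)$ such that $PA=AP$ for every $A\in \mathrm{Cy}(G)$. The automorphism group $\mathrm{Aut}(G)$ acts linearly on $\mathbb{R}^E$: an automorphism $\phi$ maps the unit vector of an oriented edge $\overrightarrow{uv}$ to the unit vector of the oriented edge $\overrightarrow{\phi(u)\phi(v)}$,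 where the vector of an edge taken against its reference orientation is the negative of its unit vector. Both $Z(G)$ and $B(G)$ are invariant under this action; the resulting real representations are called the natural representations of $\mathrm{Aut}(G)$ on $Z(G)$ and on $B(G)$. Then there is exactly one invariant projection of $\ell_2(E)$ onto $Z(G)$ if and only if the natural representations of $\mathrm{Aut}(G)$ on $Z(G)$ and on $B(G)$ do not have equivalent restrictions to nonzero subspaces, that is, there are no nonzero $\mathrm{Aut}(G)$-invariant subspaces $U\subseteq Z(G)$ and $W\subseteq B(G)$ such that the restricted representations on $U$ and $W$ are equivalent over $\mathbb{R}$. -/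

import Mathlib

noncomputable section

namespace GraphCycleSpace

/-- `G` is `k`-connected: it has more than `k` vertices, and it stays connected after the deletion
of any set of fewer than `k` vertices. -/
def IsKConnected {V : Type*} [Fintype V] (G : SimpleGraph V) (k : ℕ) : Prop :=
  k < Fintype.card V ∧
    ∀ S : Finset V, S.card < k → (G.induce {v : V | v ∉ S}).Connected

/-- A reference orientation of `G`: every edge gets a tail and a head, which are its two ends. -/
structure Orientation {V : Type*} (G : SimpleGraph V) where
  /-- the tail of an edge -/
  tail : G.edgeSet → V
  /-- the head of an edge -/
  head : G.edgeSet → V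
  /-- tail and head are the two ends of the edge -/
  ends : ∀ e : G.edgeSet, (e : Sym2 V) = s(tail e, head e)

/-- The Euclidean space `ℓ₂(E)` of real functions on the edge set. -/
abbrev EdgeSpace {V : Type*} (G : SimpleGraph V) : Type _ := EuclideanSpace ℝ G.edgeSet

namespace Orientation

variable {V : Type*} {G : SimpleGraph V} (o : Orientation G)

lemma tail_ne_head (e : G.edgeSet) : o.tail e ≠ o.head e := by
  have h := e.2
  rw [o.ends e, SimpleGraph.mem_edgeSet] at h
  exact h.ne

lemma map_ends (φ : G ≃g G) (e : G.edgeSet) :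
    (φ (o.tail e) = o.tail (φ.mapEdgeSet e) ∧ φ (o.head e) = o.head (φ.mapEdgeSet e)) ∨
      (φ (o.tail e) = o.head (φ.mapEdgeSet e) ∧ φ (o.head e) = o.tail (φ.mapEdgeSet e)) := by
  have h1 : ((φ.mapEdgeSet e : G.edgeSet) : Sym2 V) = Sym2.map φ e := rfl
  rw [o.ends (φ.mapEdgeSet e), o.ends e, Sym2.map_mk, eq_comm] at h1
  simpa [Sym2.eq_iff] using h1

variable [DecidableEq V]

/-- The incidence matrix of the oriented graph. -/
def incidence : Matrix V G.edgeSet ℝ := fun v e =>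
  if v = o.head e then 1 else if v = o.tail e then -1 else 0

/-- The sign with which the automorphism `φ` carries the oriented edge `e` to the oriented edge
`φ e`: it is `1` if `φ` respects the reference orientations of the two edges, and `-1` otherwise. -/
def sign (φ : G ≃g G) (e : G.edgeSet) : ℝ :=
  if φ (o.tail e) = o.tail (φ.mapEdgeSet e) then 1 else -1

lemma sign_mul_self (φ : G ≃g G) (e : G.edgeSet) : o.sign φ e * o.sign φ e = 1 := by
  unfold sign; split_ifs <;> norm_num

lemma incidence_map (φ : G ≃g G) (v : V) (e : G.edgeSet) :
    o.incidence (φ v) (φ.mapEdgeSet e) = o.sign φ e * o.incidence v e := by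
  have hne := o.tail_ne_head (φ.mapEdgeSet e)
  have hne' := o.tail_ne_head e
  unfold incidence sign
  rcases o.map_ends φ e with ⟨h1, h2⟩ | ⟨h1, h2⟩
  · rw [← h1, ← h2]
    simp
  · rw [← h1, ← h2] at hne
    rw [← h1, ← h2]
    simp only [EmbeddingLike.apply_eq_iff_eq]
    rw [if_neg (fun h => hne' h)]
    by_cases a : v = o.tail e
    · have : v ≠ o.head e := fun h => hne' (a ▸ h)
      simp [a, hne']
    · by_cases b : v = o.head e
      · simp [b, hne'.symm]
      · simp [a, b]

lemma sign_mul (φ ψ : G ≃g G) (e : G.edgeSet) :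
    o.sign (φ * ψ) e = o.sign ψ e * o.sign φ (ψ.mapEdgeSet e) := by
  have h : (φ * ψ).mapEdgeSet e = φ.mapEdgeSet (ψ.mapEdgeSet e) := by
    apply Subtype.ext
    change Sym2.map (φ * ψ) (e : Sym2 V) = Sym2.map φ (Sym2.map ψ e)
    rw [Sym2.map_map]; rfl
  have h1 := o.incidence_map (φ * ψ) (o.head e) e
  have h2 := o.incidence_map φ (ψ (o.head e)) (ψ.mapEdgeSet e)
  have h3 := o.incidence_map ψ (o.head e) e
  rw [h, show (φ * ψ) (o.head e) = φ (ψ (o.head e)) from rfl, h2, h3] at h1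
  have h4 : o.incidence (o.head e) e = 1 := by simp [incidence]
  rw [h4] at h1
  linarith

/-- The linear map `φ̂` of the edge space induced by an automorphism `φ`; it sends the unit vector
of the oriented edge `uv` to the unit vector of the oriented edge `φ(u)φ(v)`, where reversing an
edge changes the sign of its unit vector. -/
def autMap (φ : G ≃g G) : EdgeSpace G →ₗ[ℝ] EdgeSpace G where
  toFun f := WithLp.toLp 2 fun e =>
    o.sign φ (φ.symm.mapEdgeSet e) * f (φ.symm.mapEdgeSet e)
  map_add' f g := by ext e; simp [mul_add]
  map_smul' c f := by ext e; simp [mul_left_comm]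

lemma autMap_apply (φ : G ≃g G) (f : EdgeSpace G) (e : G.edgeSet) :
    o.autMap φ f e = o.sign φ (φ.symm.mapEdgeSet e) * f (φ.symm.mapEdgeSet e) := rfl

lemma autMap_apply_map (φ : G ≃g G) (f : EdgeSpace G) (e : G.edgeSet) :
    o.autMap φ f (φ.mapEdgeSet e) = o.sign φ e * f e := by
  have h : φ.symm.mapEdgeSet (φ.mapEdgeSet e) = e := φ.mapEdgeSet.symm_apply_apply e
  rw [autMap_apply, h]

/-- The natural representation of the automorphism group of `G` on the edge space. -/
def autRep : Representation ℝ (G ≃g G) (EdgeSpace G) where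
  toFun := o.autMap
  map_one' := by
    ext f e
    have h : (1 : G ≃g G).mapEdgeSet e = e := by
      apply Subtype.ext
      change Sym2.map id (e : Sym2 V) = e
      simp
    have h2 := o.autMap_apply_map 1 f e
    rw [h] at h2
    rw [h2]
    simp [sign, h]
  map_mul' φ ψ := by
    refine LinearMap.ext fun f => ?_
    ext e
    obtain ⟨e, rfl⟩ := (φ * ψ).mapEdgeSet.surjective e
    have h : (φ * ψ).mapEdgeSet e = φ.mapEdgeSet (ψ.mapEdgeSet e) := by
      apply Subtype.ext
      change Sym2.map (φ * ψ) (e : Sym2 V) = Sym2.map φ (Sym2.map ψ e)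
      rw [Sym2.map_map]; rfl
    rw [autMap_apply_map, sign_mul, h, Module.End.mul_apply, autMap_apply_map, autMap_apply_map]
    ring

lemma autRep_apply (φ : G ≃g G) : o.autRep φ = o.autMap φ := rfl

variable [Fintype G.edgeSet]

/-- The operator `D : ℝ^E → ℝ^V` of the incidence matrix. -/
def boundary : EdgeSpace G →ₗ[ℝ] (V → ℝ) :=
  o.incidence.mulVecLin ∘ₗ (WithLp.linearEquiv 2 ℝ (G.edgeSet → ℝ)).toLinearMap

/-- The cycle space `Z(G) = ker D`. -/
def cycleSpace : Submodule ℝ (EdgeSpace G) := LinearMap.ker o.boundary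

/-- The cut space `B(G)`, the orthogonal complement of the cycle space. -/
def cutSpace : Submodule ℝ (EdgeSpace G) := o.cycleSpaceᗮ

lemma boundary_apply (f : EdgeSpace G) (v : V) :
    o.boundary f v = ∑ e, o.incidence v e * f e := rfl

lemma boundary_autMap (φ : G ≃g G) (f : EdgeSpace G) (v : V) :
    o.boundary (o.autMap φ f) (φ v) = o.boundary f v := by
  rw [boundary_apply, boundary_apply, ← Equiv.sum_comp φ.mapEdgeSet]
  refine Finset.sum_congr rfl fun e _ => ?_
  rw [autMap_apply_map, incidence_map]
  linear_combination (o.incidence v e * f e) * o.sign_mul_self φ e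

lemma inner_autMap (φ : G ≃g G) (f g : EdgeSpace G) :
    inner ℝ (o.autMap φ f) (o.autMap φ g) = inner ℝ f g := by
  rw [PiLp.inner_apply, PiLp.inner_apply, ← Equiv.sum_comp φ.mapEdgeSet]
  refine Finset.sum_congr rfl fun e _ => ?_
  rw [autMap_apply_map, autMap_apply_map]
  simp only [RCLike.inner_apply, conj_trivial]
  linear_combination (f e * g e) * o.sign_mul_self φ e

lemma autRep_mem_cycleSpace (φ : G ≃g G) ⦃f : EdgeSpace G⦄ (hf : f ∈ o.cycleSpace) :
    o.autRep φ f ∈ o.cycleSpace := by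
  have hf' : o.boundary f = 0 := hf
  change o.boundary (o.autMap φ f) = 0
  funext v
  obtain ⟨v, rfl⟩ := φ.surjective v
  rw [boundary_autMap, hf']; rfl

lemma autRep_mem_cutSpace (φ : G ≃g G) ⦃f : EdgeSpace G⦄ (hf : f ∈ o.cutSpace) :
    o.autRep φ f ∈ o.cutSpace := by
  intro g hg
  have h : g = o.autMap φ (o.autRep φ⁻¹ g) := by
    rw [← autRep_apply, ← Module.End.mul_apply, ← map_mul]; simp
  rw [h, autRep_apply o φ, inner_autMap]
  exact hf _ (o.autRep_mem_cycleSpace φ⁻¹ hg)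

/-- The natural representation of the automorphism group on the cycle space. -/
def cycleRep : Representation ℝ (G ≃g G) o.cycleSpace :=
  (Subrepresentation.mk (ρ := o.autRep) o.cycleSpace o.autRep_mem_cycleSpace).toRepresentation

/-- The natural representation of the automorphism group on the cut space. -/
def cutRep : Representation ℝ (G ≃g G) o.cutSpace :=
  (Subrepresentation.mk (ρ := o.autRep) o.cutSpace o.autRep_mem_cutSpace).toRepresentation

/-- The group `Cy(G)` of the linear isometries of `ℓ₁(E)` for which the cycle space is invariant,
regarded as operators on `ℝ^E`. -/
def cycleIsometryGroup : Subgroup (EdgeSpace G ≃ₗ[ℝ] EdgeSpace G) where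
  carrier := {A | (∀ f, ‖WithLp.toLp 1 (A f).ofLp‖ = ‖WithLp.toLp 1 f.ofLp‖) ∧
    ∀ f ∈ o.cycleSpace, A f ∈ o.cycleSpace}
  one_mem' := ⟨fun _ => rfl, fun _ h => h⟩
  mul_mem' := fun {A B} hA hB =>
    ⟨fun f => (hA.1 (B f)).trans (hB.1 f), fun f hf => hA.2 _ (hB.2 f hf)⟩
  inv_mem' := fun {A} hA => by
    have hinv : ∀ f, A (A⁻¹ f) = f := A.apply_symm_apply
    refine ⟨fun f => ?_, fun f hf => ?_⟩
    · rw [← hA.1 (A⁻¹ f), hinv]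
    · have hle : o.cycleSpace.map (A : EdgeSpace G →ₗ[ℝ] EdgeSpace G) ≤ o.cycleSpace := by
        rintro _ ⟨g, hg, rfl⟩
        exact hA.2 g hg
      have heq := Submodule.eq_of_le_of_finrank_eq hle (LinearEquiv.finrank_map_eq A _)
      rw [← heq] at hf
      obtain ⟨g, hg, hgf⟩ := hf
      have : A⁻¹ f = g := by rw [← hgf]; exact A.symm_apply_apply g
      rwa [this]

/-- `P` is an invariant projection of the edge space onto the cycle space: a linear projection
onto it that commutes with every element of `Cy(G)`. -/
def IsInvariantProjection (P : EdgeSpace G →ₗ[ℝ] EdgeSpace G) : Prop :=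
  LinearMap.IsProj o.cycleSpace P ∧ ∀ A ∈ o.cycleIsometryGroup, ∀ f, P (A f) = A (P f)

end Orientation

/-- Two representations have equivalent restrictions to nonzero (invariant) subspaces. -/
def HaveEquivalentRestrictions {Γ X Y : Type*} [Group Γ] [AddCommGroup X] [Module ℝ X]
    [AddCommGroup Y] [Module ℝ Y] (ρ : Representation ℝ Γ X) (σ : Representation ℝ Γ Y) : Prop :=
  ∃ (U : Subrepresentation ρ) (W : Subrepresentation σ),
    U.toSubmodule ≠ ⊥ ∧ W.toSubmodule ≠ ⊥ ∧
      Nonempty (Representation.Equiv U.toRepresentation W.toRepresentation)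

end GraphCycleSpace

end

/-!
An isometry of `ℓ₁(E)` is a signed permutation of the coordinates (`exists_signedPerm`), hence
orthogonal on `ℓ₂(E)`. So the elements of `Cy(G)` also preserve the cut space, and the orthogonal
projection onto the cycle space is an invariant projection. Any other invariant projection differs
from it by a nonzero linear map of the cut space into the cycle space commuting with `Cy(G)`. By
orthogonality of the representations, such a map for `Aut(G)` in place of `Cy(G)` exists exactly if
the two natural representations have equivalent restrictions to nonzero subspaces
(`haveEquivalentRestrictions_iff`).

What remains is that `Cy(G)` consists of the operators of the automorphisms of `G` and their
negatives (`exists_eq_smul_autMap`), a signed form of Whitney's theorem that a 3-connected graph is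
determined by its cycle matroid. The proof works on the cut space, which is the space of gradients
of functions on the vertices (`cutSpace_eq_range_grad`), and shows that an element of `Cy(G)` maps
vertex stars to vertex stars (`exists_smul_grad_single`). The image of the star of `v` is some
gradient `grad q`. The edges outside its support correspond to the edges of `G - v`, and because
`G - v` remains connected when a further vertex is deleted, these images all lie on a single level
of `q` (`exists_forall_eq_of_notMem`). All edges at a vertex `w` off that level then belong to the
support, and minimality of the star of `v` gives that its image is plus or minus the star of `w`.
The resulting map `v ↦ w` is the automorphism sought, and connectedness of `G` makes the sign the
same for all vertices.
-/

noncomputable section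

namespace GraphCycleSpace

/-! ### Isometries of `ℓ₁` -/

/-- A linear isometry of the finite-dimensional `ℓ₁` permutes the coordinates up to sign. The reason
is that `f` and `g` have disjoint supports exactly when `‖f + g‖ + ‖f - g‖ = 2 (‖f‖ + ‖g‖)`, so that
the unit vectors are mapped to as many nonzero vectors with disjoint supports as there are
coordinates. -/
theorem exists_signedPerm {ι : Type*} [Fintype ι]
    (A : EuclideanSpace ℝ ι ≃ₗ[ℝ] EuclideanSpace ℝ ι)
    (hA : ∀ f, ‖WithLp.toLp 1 (A f).ofLp‖ = ‖WithLp.toLp 1 f.ofLp‖) :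
    ∃ (σ : Equiv.Perm ι) (s : ι → ℝ), (∀ e, s e * s e = 1) ∧ ∀ f e, A f (σ e) = s e * f e := by
  classical
  have norm_eq (f : EuclideanSpace ℝ ι) : ‖WithLp.toLp 1 f.ofLp‖ = ∑ e, |f e| := by
    simp [PiLp.norm_eq_of_L1]
  have hA' (f) : ∑ e, |A f e| = ∑ e, |f e| := by rw [← norm_eq, ← norm_eq, hA]
  -- Equality in `key` summed over the coordinates is equality in each of them.
  have key (a b : ℝ) : |a + b| + |a - b| ≤ 2 * (|a| + |b|) := by
    linarith [abs_add_le a b, abs_sub a b]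
  have key' (a b : ℝ) (h : |a + b| + |a - b| = 2 * (|a| + |b|)) : a = 0 ∨ b = 0 := by
    by_contra! hc
    have := abs_pos.2 hc.1
    have := abs_pos.2 hc.2
    rcases abs_cases a with ⟨h1, _⟩ | ⟨h1, _⟩ <;> rcases abs_cases b with ⟨h2, _⟩ | ⟨h2, _⟩ <;>
    rcases abs_cases (a + b) with ⟨h3, _⟩ | ⟨h3, _⟩ <;>
    rcases abs_cases (a - b) with ⟨h4, _⟩ | ⟨h4, _⟩ <;> linarith
  let u (i : ι) : EuclideanSpace ℝ ι := EuclideanSpace.single i 1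
  have disj (i j : ι) (hij : i ≠ j) (e : ι) : A (u i) e = 0 ∨ A (u j) e = 0 := by
    apply key'
    have hs : ∑ e, (|A (u i) e + A (u j) e| + |A (u i) e - A (u j) e|) =
        ∑ e, 2 * (|A (u i) e| + |A (u j) e|) := by
      rw [Finset.sum_add_distrib, ← Finset.mul_sum, Finset.sum_add_distrib]
      have h1 := hA' (u i + u j)
      have h2 := hA' (u i - u j)
      simp only [map_add, map_sub, PiLp.add_apply, PiLp.sub_apply] at h1 h2
      rw [h1, h2, hA', hA', ← Finset.sum_add_distrib, ← Finset.sum_add_distrib, Finset.mul_sum]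
      refine Finset.sum_congr rfl fun e _ => ?_
      by_cases h1 : e = i
      · subst h1
        simp [u, hij]
        norm_num
      · by_cases h2 : e = j
        · subst h2
          simp [u, Ne.symm hij]
          norm_num
        · simp [u, h1, h2]
    exact (Finset.sum_eq_sum_iff_of_le fun e _ => key _ _).1 hs e (Finset.mem_univ e)
  have hne (i : ι) : ∃ e, A (u i) e ≠ 0 := by
    by_contra! h
    have : A (u i) = 0 := by ext e; exact h e
    have h0 : u i = 0 := by simpa using this
    have := congrArg (fun f : EuclideanSpace ℝ ι => f i) h0
    simp [u] at this
  choose τ hτ using hne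
  have hinj : Function.Injective τ := fun i j h => by
    by_contra hij
    rcases disj i j hij (τ i) with h1 | h1
    · exact hτ i h1
    · rw [h] at h1; exact hτ j h1
  let σ := Equiv.ofBijective τ (Finite.injective_iff_bijective.1 hinj)
  have hz (i j : ι) (hij : i ≠ j) : A (u i) (σ j) = 0 :=
    (disj i j hij (σ j)).resolve_right (hτ j)
  have happ (f : EuclideanSpace ℝ ι) (e : ι) : A f (σ e) = A (u e) (σ e) * f e := by
    have hf : f = ∑ i, f i • u i := by
      ext j
      simp [u, Pi.single_apply]
    conv_lhs => rw [hf]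
    simp only [map_sum, map_smul]
    rw [WithLp.ofLp_sum, Finset.sum_apply, Finset.sum_eq_single e]
    · simp [mul_comm]
    · intro i _ hi
      simp [hz i e hi]
    · simp
  refine ⟨σ, fun e => A (u e) (σ e), fun e => ?_, happ⟩
  have h1 := hA' (u e)
  rw [← Equiv.sum_comp σ] at h1
  rw [Finset.sum_eq_single e (fun j _ hj => by rw [hz e j hj.symm, abs_zero]) (by simp),
    Finset.sum_eq_single e (fun j _ hj => by simp [u, hj]) (by simp)] at h1
  have h2 : |A (u e) (σ e)| = 1 := by simpa [u] using h1
  rw [← abs_mul_abs_self, h2, one_mul]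

/-! ### Orthogonal representations -/

theorem starProjection_comm_of_invariant {E : Type*} [NormedAddCommGroup E] [InnerProductSpace ℝ E]
    (K : Submodule ℝ E) [K.HasOrthogonalProjection] (A : E →ₗ[ℝ] E)
    (h1 : ∀ f ∈ K, A f ∈ K) (h2 : ∀ f ∈ Kᗮ, A f ∈ Kᗮ) (f : E) :
    K.starProjection (A f) = A (K.starProjection f) := by
  apply Submodule.eq_starProjection_of_mem_orthogonal
  · exact h1 _ (K.starProjection_apply_mem f)
  · rw [← map_sub]
    exact h2 _ (K.sub_starProjection_mem_orthogonal f)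

theorem invariant_orthogonal {Γ Y : Type*} [Group Γ] [NormedAddCommGroup Y]
    [InnerProductSpace ℝ Y] {σ : Representation ℝ Γ Y}
    (hσ : ∀ g x y, inner ℝ (σ g x) (σ g y) = inner ℝ x y) {K : Submodule ℝ Y}
    (hK : ∀ g, ∀ y ∈ K, σ g y ∈ K) (g : Γ) (y : Y) (hy : y ∈ Kᗮ) : σ g y ∈ Kᗮ := by
  intro x hx
  rw [← hσ g⁻¹, ← Module.End.mul_apply (σ g⁻¹) (σ g) y, ← map_mul, inv_mul_cancel, map_one]
  exact hy _ (hK _ _ hx)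

/-- When one of the two representations is orthogonal, equivalent nonzero subrepresentations give a
nonzero intertwining map by composition with the orthogonal projection; conversely a nonzero
intertwining map is an equivalence of the orthogonal complement of its kernel with its range. -/
theorem haveEquivalentRestrictions_iff {Γ X Y : Type*} [Group Γ] [AddCommGroup X] [Module ℝ X]
    [NormedAddCommGroup Y] [InnerProductSpace ℝ Y] [FiniteDimensional ℝ Y]
    (ρ : Representation ℝ Γ X) (σ : Representation ℝ Γ Y)
    (hσ : ∀ g x y, inner ℝ (σ g x) (σ g y) = inner ℝ x y) :
    HaveEquivalentRestrictions ρ σ ↔ ∃ T : σ.IntertwiningMap ρ, T ≠ 0 := by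
  constructor
  · rintro ⟨U, W, -, hW, ⟨ψ⟩⟩
    let π : Y →ₗ[ℝ] W.toSubmodule := W.toSubmodule.orthogonalProjectionOnto.toLinearMap
    have hπ (g : Γ) (y : Y) : π (σ g y) = W.toRepresentation g (π y) :=
      Subtype.ext <| starProjection_comm_of_invariant W.toSubmodule (σ g)
        (fun _ h => W.apply_mem_toSubmodule g h)
        (invariant_orthogonal hσ (fun g _ h => W.apply_mem_toSubmodule g h) g) y
    refine ⟨(U.toSubmodule.subtype ∘ₗ ψ.symm.toLinearMap ∘ₗ π).intertwiningMap_of_isIntertwiningMap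
      σ ρ fun g y => ?_, fun h => ?_⟩
    · have := ψ.symm.toIntertwiningMap.isIntertwining _ _ g (π y)
      simp only [LinearMap.comp_apply, hπ]
      exact congrArg Subtype.val this
    · obtain ⟨w, hw, hw0⟩ := Submodule.exists_mem_ne_zero_of_ne_bot hW
      have h1 : ((ψ.symm (π w) : U.toSubmodule) : X) = 0 := DFunLike.congr_fun h w
      have h2 : π w = 0 := by
        rw [Submodule.coe_eq_zero] at h1
        exact (map_eq_zero_iff ψ.symm (EquivLike.injective ψ.symm)).1 h1
      have h3 : π w = ⟨w, hw⟩ := Submodule.orthogonalProjectionOnto_mem_subspace_eq_self ⟨w, hw⟩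
      rw [h2] at h3
      exact hw0 (congrArg Subtype.val h3).symm
  · rintro ⟨T, hT⟩
    let W : Subrepresentation σ := ⟨T.ker.toSubmoduleᗮ, fun g y hy =>
      invariant_orthogonal hσ (fun g _ h => T.ker.apply_mem_toSubmodule g h) g y hy⟩
    let f : W.toSubmodule →ₗ[ℝ] T.range.toSubmodule :=
      (T.toLinearMap.comp W.toSubmodule.subtype).codRestrict _ fun w => ⟨w, rfl⟩
    have hker (y : Y) : T (T.ker.toSubmodule.starProjection y) = 0 :=
      T.ker.toSubmodule.starProjection_apply_mem y
    have hbij : Function.Bijective f := by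
      refine ⟨(injective_iff_map_eq_zero f).2 fun w hw => ?_, ?_⟩
      · have h : (w : Y) ∈ T.ker.toSubmodule := congrArg Subtype.val hw
        exact Subtype.ext (Submodule.disjoint_def.1 (Submodule.orthogonal_disjoint _) _ h w.2)
      · rintro ⟨_, y, rfl⟩
        refine ⟨⟨y - T.ker.toSubmodule.starProjection y,
          Submodule.sub_starProjection_mem_orthogonal y⟩, Subtype.ext ?_⟩
        change T (y - _) = T y
        rw [map_sub, hker, sub_zero]
    have hne : ∃ y, T y ≠ 0 := by
      by_contra! h
      exact hT (DFunLike.ext _ _ h)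
    obtain ⟨y, hy⟩ := hne
    have hU : T.range.toSubmodule ≠ ⊥ := fun h => hy <| by
      have : T y ∈ T.range.toSubmodule := ⟨y, rfl⟩
      rwa [h] at this
    refine ⟨T.range, W, hU, fun h => ?_, ⟨Representation.Equiv.symm
      (Representation.Equiv.mk (LinearEquiv.ofBijective f hbij) fun g => ?_)⟩⟩
    · have : y - T.ker.toSubmodule.starProjection y ∈ W.toSubmodule :=
        Submodule.sub_starProjection_mem_orthogonal y
      rw [h, Submodule.mem_bot, sub_eq_zero] at this
      exact hy (this ▸ hker y)
    · ext w
      exact T.isIntertwining _ _ g w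

/-! ### Gradients and the cut space -/

/-- After the deletion of fewer than `k` vertices, a function which is constant along edges is
constant. All uses of connectivity go through this lemma. -/
theorem IsKConnected.eq_of_forall_adj {V : Type*} [Fintype V] {G : SimpleGraph V} {k : ℕ}
    (hG : IsKConnected G k) {S : Finset V} (hS : S.card < k) {α : Type*} {p : V → α}
    (hp : ∀ a b, G.Adj a b → a ∉ S → b ∉ S → p a = p b) {a b : V} (ha : a ∉ S) (hb : b ∉ S) :
    p a = p b := by
  obtain ⟨w⟩ := (hG.2 S hS).preconnected ⟨a, ha⟩ ⟨b, hb⟩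
  have main : ∀ x y : {v : V | v ∉ S}, (G.induce {v : V | v ∉ S}).Walk x y → p x = p y := by
    intro x y w
    induction w with
    | nil => rfl
    | @cons x y z h _ ih => exact (hp x y h x.2 y.2).trans ih
  exact main _ _ w

namespace Orientation

variable {V : Type*} [DecidableEq V] {G : SimpleGraph V} (o : Orientation G)

/-- The gradient of a potential `p`: its difference along each edge, head minus tail. It is the
transpose of `boundary`. The star of a vertex `v` in the cut space is `grad (Pi.single v 1)`. -/
def grad : (V → ℝ) →ₗ[ℝ] EdgeSpace G where
  toFun p := WithLp.toLp 2 fun e => p (o.head e) - p (o.tail e)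
  map_add' p q := by ext e; simp; ring
  map_smul' c p := by ext e; simp; ring

omit [DecidableEq V] in
theorem grad_apply (p : V → ℝ) (e : G.edgeSet) : o.grad p e = p (o.head e) - p (o.tail e) := rfl

omit [DecidableEq V] in
theorem mem_edge_iff {v : V} {e : G.edgeSet} :
    v ∈ (e : Sym2 V) ↔ v = o.tail e ∨ v = o.head e := by
  rw [o.ends e, Sym2.mem_iff]

omit [DecidableEq V] in
theorem tail_mem (e : G.edgeSet) : o.tail e ∈ (e : Sym2 V) := o.mem_edge_iff.2 (.inl rfl)

omit [DecidableEq V] in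
theorem head_mem (e : G.edgeSet) : o.head e ∈ (e : Sym2 V) := o.mem_edge_iff.2 (.inr rfl)

theorem grad_single (v : V) (e : G.edgeSet) : o.grad (Pi.single v 1) e = o.incidence v e := by
  have := o.tail_ne_head e
  rw [grad_apply, incidence]
  by_cases h1 : v = o.head e
  · subst h1; simp [this]
  · by_cases h2 : v = o.tail e
    · subst h2; simp [this.symm, this]
    · simp [h1, h2, Ne.symm h1, Ne.symm h2]

theorem incidence_ne_zero_iff {v : V} {e : G.edgeSet} :
    o.incidence v e ≠ 0 ↔ v ∈ (e : Sym2 V) := by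
  rw [o.mem_edge_iff, incidence]; split_ifs <;> simp_all

theorem incidence_mul_self {v : V} {e : G.edgeSet} (h : v ∈ (e : Sym2 V)) :
    o.incidence v e * o.incidence v e = 1 := by
  rw [← o.incidence_ne_zero_iff] at h
  revert h
  unfold incidence
  split_ifs <;> simp

omit [DecidableEq V] in
theorem grad_eq_or_of_eq (p : V → ℝ) {e : G.edgeSet} {a b : V} (he : (e : Sym2 V) = s(a, b)) :
    o.grad p e = p b - p a ∨ o.grad p e = -(p b - p a) := by
  rw [grad_apply]
  have h := o.ends e
  rw [he, Sym2.eq_iff] at h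
  rcases h with ⟨h1, h2⟩ | ⟨h1, h2⟩ <;> rw [h1, h2] <;> simp

omit [DecidableEq V] in
theorem grad_eq_zero_iff (p : V → ℝ) {e : G.edgeSet} {a b : V} (he : (e : Sym2 V) = s(a, b)) :
    o.grad p e = 0 ↔ p a = p b := by
  rcases o.grad_eq_or_of_eq p he with h | h <;> rw [h] <;> constructor <;> intro h <;> linarith

variable [Fintype G.edgeSet]

theorem inner_grad [Fintype V] (p : V → ℝ) (f : EdgeSpace G) :
    inner ℝ (o.grad p) f = ∑ v, p v * o.boundary f v := by
  simp only [boundary_apply, Finset.mul_sum]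
  rw [Finset.sum_comm, PiLp.inner_apply]
  refine Finset.sum_congr rfl fun e _ => ?_
  have h : o.grad p e = ∑ v, p v * o.incidence v e := by
    conv_lhs => rw [← Finset.univ_sum_single p]
    rw [map_sum, WithLp.ofLp_sum, Finset.sum_apply]
    refine Finset.sum_congr rfl fun v _ => ?_
    rw [← grad_single, ← mul_one (p v), ← smul_eq_mul, Pi.single_smul, map_smul]
    simp
  simp only [← mul_assoc]
  rw [← Finset.sum_mul, ← h]
  simp [mul_comm]

theorem orthogonal_range_grad [Fintype V] : (LinearMap.range o.grad)ᗮ = o.cycleSpace := by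
  ext f
  constructor
  · intro hf
    change o.boundary f = 0
    funext v
    have := hf _ ⟨Pi.single v 1, rfl⟩
    rw [inner_grad, Finset.sum_eq_single v] at this
    · simpa using this
    · intro w _ hw; simp [hw]
    · simp
  · rintro hf _ ⟨p, rfl⟩
    have hf' : o.boundary f = 0 := hf
    simp [inner_grad, hf']

theorem cutSpace_eq_range_grad [Fintype V] : o.cutSpace = LinearMap.range o.grad := by
  rw [cutSpace, ← orthogonal_range_grad, Submodule.orthogonal_orthogonal]

theorem inner_of_mem_cycleIsometryGroup {A : EdgeSpace G ≃ₗ[ℝ] EdgeSpace G}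
    (hA : A ∈ o.cycleIsometryGroup) (f g : EdgeSpace G) : inner ℝ (A f) (A g) = inner ℝ f g := by
  obtain ⟨σ, s, hs, h⟩ := exists_signedPerm A hA.1
  rw [PiLp.inner_apply, PiLp.inner_apply, ← Equiv.sum_comp σ]
  refine Finset.sum_congr rfl fun e _ => ?_
  rw [h, h]
  simp only [RCLike.inner_apply, conj_trivial]
  linear_combination (f e * g e) * hs e

theorem cutSpace_of_mem_cycleIsometryGroup {A : EdgeSpace G ≃ₗ[ℝ] EdgeSpace G}
    (hA : A ∈ o.cycleIsometryGroup) {f : EdgeSpace G} (hf : f ∈ o.cutSpace) : A f ∈ o.cutSpace := by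
  intro g hg
  rw [← A.apply_symm_apply g, o.inner_of_mem_cycleIsometryGroup hA]
  exact hf _ ((o.cycleIsometryGroup.inv_mem hA).2 g hg)

theorem exists_grad_eq [Fintype V] {A : EdgeSpace G ≃ₗ[ℝ] EdgeSpace G}
    (hA : A ∈ o.cycleIsometryGroup) (p : V → ℝ) : ∃ q, o.grad q = A (o.grad p) := by
  change A (o.grad p) ∈ LinearMap.range o.grad
  rw [← cutSpace_eq_range_grad]
  apply o.cutSpace_of_mem_cycleIsometryGroup hA
  rw [cutSpace_eq_range_grad]
  exact ⟨p, rfl⟩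

end Orientation

/-! ### Whitney's theorem for isometries preserving the cycle space -/

/-- Otherwise `a` would be isolated after the deletion of `b`. -/
theorem IsKConnected.exists_edge_mem_notMem {V : Type*} [Fintype V] {G : SimpleGraph V}
    (hG : IsKConnected G 3) {a b : V} (hab : a ≠ b) :
    ∃ e : G.edgeSet, a ∈ (e : Sym2 V) ∧ b ∉ (e : Sym2 V) := by
  classical
  by_contra! h
  obtain ⟨c, hc⟩ : ∃ c, c ∉ ({a, b} : Finset V) := by
    by_contra! hall
    have h1 := Finset.card_le_card fun x (_ : x ∈ (Finset.univ : Finset V)) => hall x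
    have h2 : Finset.card ({a, b} : Finset V) ≤ 2 := Finset.card_le_two
    have h3 := hG.1
    rw [Finset.card_univ] at h1
    omega
  simp only [Finset.mem_insert, Finset.mem_singleton, not_or] at hc
  have hadj (x y : V) (hxy : G.Adj x y) (hy : y ∉ ({b} : Finset V)) : x ≠ a := by
    rintro rfl
    have := h ⟨s(x, y), hxy⟩ (Sym2.mem_mk_left x y)
    rcases Sym2.mem_iff.1 this with h1 | h1
    · exact hab h1.symm
    · exact hy (by simp [h1])
  have := hG.eq_of_forall_adj (S := {b}) (by simp) (p := fun x => x = a) (a := a) (b := c)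
    (fun x y hxy hx hy => by simp [hadj x y hxy hy, hadj y x hxy.symm hx])
    (by simpa using hab) (by simpa using hc.2)
  simp [hc.1] at this

namespace Orientation

variable {V : Type*} [DecidableEq V] {G : SimpleGraph V} (o : Orientation G)

theorem incidence_eq_neg {a b : V} (hab : a ≠ b) {e : G.edgeSet} (ha : a ∈ (e : Sym2 V))
    (hb : b ∈ (e : Sym2 V)) : o.incidence a e = -o.incidence b e := by
  have := o.tail_ne_head e
  rw [o.mem_edge_iff] at ha hb
  rcases ha with rfl | rfl <;> rcases hb with rfl | rfl <;> simp_all [incidence]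

variable [Fintype V] [Fintype G.edgeSet] {A : EdgeSpace G ≃ₗ[ℝ] EdgeSpace G}
  {σ : Equiv.Perm G.edgeSet} {s : G.edgeSet → ℝ}

/-- The images under `σ` of the edges avoiding `v` all lie in one level set of `q`, as soon as `q`
is constant along each of them. This expresses that the cycle matroid of the graph `G - v` is
connected, and it is the one place where deleting two vertices is needed. -/
theorem exists_forall_eq_of_notMem (hG : IsKConnected G 3) (hA : A ∈ o.cycleIsometryGroup)
    (hs : ∀ e, s e * s e = 1) (h : ∀ f e, A f (σ e) = s e * f e) (v : V) (q : V → ℝ)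
    (hq : ∀ e : G.edgeSet, v ∉ (e : Sym2 V) → o.grad q (σ e) = 0) :
    ∃ t, ∀ e : G.edgeSet, v ∉ (e : Sym2 V) → ∀ x ∈ (σ e : Sym2 V), q x = t := by
  classical
  have hs0 (e) : s e ≠ 0 := fun h0 => by simpa [h0] using hs e
  have htail (e : G.edgeSet) (he : v ∉ (e : Sym2 V)) : q (o.tail (σ e)) = q (o.head (σ e)) :=
    (o.grad_eq_zero_iff q (o.ends (σ e))).1 (hq e he)
  -- Two edges at `u` that avoid `v` have images on the same level of `q`: otherwise, cutting off
  -- the potential of `A (grad 1ᵤ)` outside the level of `σ e` and pulling back by `A` gives a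
  -- potential `r` which is constant off `{u, v}` and has nonzero gradient on `e` but zero gradient
  -- on `e'`.
  have step (u : V) (e e' : G.edgeSet) (hue : u ∈ (e : Sym2 V)) (hue' : u ∈ (e' : Sym2 V))
      (hve : v ∉ (e : Sym2 V)) (hve' : v ∉ (e' : Sym2 V)) :
      q (o.head (σ e)) = q (o.head (σ e')) := by
    by_contra hne
    obtain ⟨p, hp⟩ := o.exists_grad_eq hA (Pi.single u 1)
    obtain ⟨r, hr⟩ :=
      o.exists_grad_eq (o.cycleIsometryGroup.inv_mem hA)
        (fun x => if q x = q (o.head (σ e)) then p x else 0)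
    have hr' (f : G.edgeSet) (hf : v ∉ (f : Sym2 V)) : o.grad r f =
        if q (o.head (σ f)) = q (o.head (σ e)) then o.incidence u f else 0 := by
      apply mul_left_cancel₀ (hs0 f)
      have h1 : A (o.grad r) = o.grad fun x => if q x = q (o.head (σ e)) then p x else 0 := by
        rw [hr]; exact A.apply_symm_apply _
      have h2 := h (o.grad (Pi.single u 1)) f
      rw [← h, h1, grad_apply, htail f hf]
      rw [← hp, grad_single, grad_apply] at h2
      split_ifs
      · exact h2
      · simp
    have hadj (a b : V) (hab : G.Adj a b) (ha : a ∉ ({u, v} : Finset V))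
        (hb : b ∉ ({u, v} : Finset V)) : r a = r b := by
      simp only [Finset.mem_insert, Finset.mem_singleton, not_or] at ha hb
      rw [← o.grad_eq_zero_iff r (e := ⟨s(a, b), hab⟩) rfl, hr']
      · split_ifs
        · by_contra h0
          have := o.incidence_ne_zero_iff.1 h0
          rcases Sym2.mem_iff.1 this with h1 | h1
          · exact ha.1 h1.symm
          · exact hb.1 h1.symm
        · rfl
      · intro hv
        rcases Sym2.mem_iff.1 hv with h1 | h1
        · exact ha.2 h1.symm
        · exact hb.2 h1.symm
    have hend (f : G.edgeSet) (huf : u ∈ (f : Sym2 V)) (hvf : v ∉ (f : Sym2 V)) :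
        ∃ x, (f : Sym2 V) = s(u, x) ∧ x ∉ ({u, v} : Finset V) := by
      obtain ⟨x, hx⟩ := huf
      refine ⟨x, hx, ?_⟩
      have h1 := f.2
      rw [hx, SimpleGraph.mem_edgeSet] at h1
      simp only [Finset.mem_insert, Finset.mem_singleton, not_or]
      exact ⟨h1.ne', fun hxv => hvf (by rw [hx, hxv]; exact Sym2.mem_mk_right _ _)⟩
    obtain ⟨x, hx, hx'⟩ := hend e hue hve
    obtain ⟨y, hy, hy'⟩ := hend e' hue' hve'
    have hxy := hG.eq_of_forall_adj (Finset.card_le_two.trans_lt (by norm_num)) hadj hx' hy'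
    have h1 : o.grad r e' = 0 := by rw [hr' e' hve', if_neg (Ne.symm hne)]
    have h2 : o.grad r e ≠ 0 := by
      rw [hr' e hve, if_pos rfl]; exact o.incidence_ne_zero_iff.2 hue
    rw [o.grad_eq_zero_iff r hy] at h1
    rw [Ne, o.grad_eq_zero_iff r hx, hxy] at h2
    exact h2 h1
  by_cases hex : ∃ e₀ : G.edgeSet, v ∉ (e₀ : Sym2 V)
  · obtain ⟨e₀, he₀⟩ := hex
    refine ⟨q (o.head (σ e₀)), fun e he x hx => ?_⟩
    have hqx : q x = q (o.head (σ e)) := by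
      rcases o.mem_edge_iff.1 hx with rfl | rfl
      · exact htail e he
      · rfl
    rw [hqx]
    -- Connectedness of `G - v` propagates the level from `e` to `e₀`; the levels of the images of
    -- the edges at a vertex are collected in a set, which as a function of the vertex is constant
    -- along edges.
    have hset := hG.eq_of_forall_adj (S := {v}) (by simp)
      (p := fun x => {t | ∃ f : G.edgeSet, v ∉ (f : Sym2 V) ∧ x ∈ (f : Sym2 V) ∧
        q (o.head (σ f)) = t}) (a := o.head e) (b := o.head e₀) ?_
      (fun hm => he (by rw [← Finset.mem_singleton.1 hm]; exact o.head_mem e))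
      (fun hm => he₀ (by rw [← Finset.mem_singleton.1 hm]; exact o.head_mem e₀))
    · have hmem : q (o.head (σ e)) ∈ {t | ∃ f : G.edgeSet, v ∉ (f : Sym2 V) ∧
          o.head e ∈ (f : Sym2 V) ∧ q (o.head (σ f)) = t} := ⟨e, he, o.head_mem e, rfl⟩
      rw [hset] at hmem
      obtain ⟨f, hf, hf', hft⟩ := hmem
      rw [← hft]
      exact step _ f e₀ hf' (o.head_mem e₀) hf he₀
    · intro a b hab ha hb
      have hv : v ∉ s(a, b) := by
        rw [Sym2.mem_iff]
        rintro (rfl | rfl) <;> simp_all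
      ext t
      constructor
      · rintro ⟨f, hf, hf', rfl⟩
        exact ⟨⟨s(a, b), hab⟩, hv, Sym2.mem_mk_right a b,
          step a _ f (Sym2.mem_mk_left a b) hf' hv hf⟩
      · rintro ⟨f, hf, hf', rfl⟩
        exact ⟨⟨s(a, b), hab⟩, hv, Sym2.mem_mk_left a b,
          step b _ f (Sym2.mem_mk_right a b) hf' hv hf⟩
  · push Not at hex
    exact ⟨0, fun e he => absurd (hex e) he⟩

/-- An isometry that preserves the cycle space maps the star of every vertex to a star, up to
sign. -/
theorem exists_smul_grad_single (hG : IsKConnected G 3) (hA : A ∈ o.cycleIsometryGroup)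
    (hs : ∀ e, s e * s e = 1) (h : ∀ f e, A f (σ e) = s e * f e) (v : V) :
    ∃ (w : V) (ε : ℝ), ε * ε = 1 ∧
      A (o.grad (Pi.single v 1)) = ε • o.grad (Pi.single w 1) := by
  have hs0 (e) : s e ≠ 0 := fun h0 => by simpa [h0] using hs e
  obtain ⟨v', hv'⟩ : ∃ v', v ≠ v' := by
    have : Nontrivial V := Fintype.one_lt_card_iff_nontrivial.1 (by have := hG.1; omega)
    obtain ⟨v', hv'⟩ := exists_ne v
    exact ⟨v', hv'.symm⟩
  obtain ⟨q, hq⟩ := o.exists_grad_eq hA (Pi.single v 1)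
  have hq' (e) : o.grad q (σ e) = s e * o.incidence v e := by rw [hq, h, grad_single]
  obtain ⟨t, ht⟩ := o.exists_forall_eq_of_notMem hG hA hs h v q fun e he => by
    rw [hq', not_not.1 fun h0 => he (o.incidence_ne_zero_iff.1 h0), mul_zero]
  -- The image of the star of `v` is the gradient of a nonconstant `q`, and the edges outside its
  -- support lie on one level of `q`; a vertex `w` off that level has all its edges in the support.
  obtain ⟨w, hw⟩ : ∃ w, ∀ e : G.edgeSet, w ∈ (σ e : Sym2 V) → v ∈ (e : Sym2 V) := by
    by_contra! hcon
    have hqt (w) : q w = t := by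
      obtain ⟨e, he, he'⟩ := hcon w
      exact ht e he' w he
    obtain ⟨e, he, -⟩ := hG.exists_edge_mem_notMem hv'
    have h1 := hq' e
    rw [grad_apply, hqt, hqt, sub_self] at h1
    exact mul_ne_zero (hs0 e) (o.incidence_ne_zero_iff.2 he) h1.symm
  obtain ⟨r, hr⟩ :=
      o.exists_grad_eq (o.cycleIsometryGroup.inv_mem hA) (Pi.single w 1)
  -- The preimage `grad r` of the star of `w` is supported on the edges at `v`, so `r` is constant
  -- off `v` and `grad r` is a multiple of the star of `v`.
  have hAr : A (o.grad r) = o.grad (Pi.single w 1) := by rw [hr]; exact A.apply_symm_apply _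
  have hr0 (e : G.edgeSet) (he : v ∉ (e : Sym2 V)) : o.grad r e = 0 := by
    apply (mul_eq_zero_iff_left (hs0 e)).1
    rw [← h, hAr, grad_single]
    exact not_not.1 fun h0 => he (hw e (o.incidence_ne_zero_iff.1 h0))
  have hconst (x : V) (hx : x ≠ v) : r x = r v' := by
    refine hG.eq_of_forall_adj (S := {v}) (by simp) (fun a b hab ha hb => ?_)
      (by simpa using hx) (by simpa using hv'.symm)
    rw [← o.grad_eq_zero_iff r (e := ⟨s(a, b), hab⟩) rfl]
    apply hr0
    rw [Sym2.mem_iff]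
    rintro (rfl | rfl) <;> simp_all
  have hgrad : o.grad r = (r v - r v') • o.grad (Pi.single v 1) := by
    ext e
    rw [PiLp.smul_apply, grad_apply, grad_apply, smul_eq_mul]
    by_cases h1 : o.head e = v <;> by_cases h2 : o.tail e = v
    · simp [h1, h2]
    · simp [h1, h2, hconst _ h2]
    · simp [h1, h2, hconst _ h1]
    · simp [h1, h2, hconst _ h1, hconst _ h2]
  set c := r v - r v'
  have hc : o.grad (Pi.single w 1) = c • A (o.grad (Pi.single v 1)) := by
    rw [← hAr, hgrad, map_smul]
  have hcc : c * c = 1 := by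
    obtain ⟨f, hf⟩ : ∃ f : G.edgeSet, w ∈ (f : Sym2 V) := by
      have : Nontrivial V := ⟨v, v', hv'⟩
      obtain ⟨w', hw'⟩ := exists_ne w
      obtain ⟨f, hf, -⟩ := hG.exists_edge_mem_notMem hw'.symm
      exact ⟨f, hf⟩
    obtain ⟨e, rfl⟩ := σ.surjective f
    have h1 : o.incidence w (σ e) = c * (s e * o.incidence v e) := by
      rw [← grad_single, hc, PiLp.smul_apply, h, grad_single, smul_eq_mul]
    have h4 := o.incidence_mul_self hf
    have h5 := o.incidence_mul_self (hw e hf)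
    rw [h1] at h4
    linear_combination h4 - c * c * s e * s e * h5 - c * c * hs e
  exact ⟨w, c, hcc, by rw [hc, smul_smul, hcc, one_smul]⟩

/-- Whitney's theorem for 3-connected graphs, with signs: every isometry that preserves the cycle
space is induced, up to a global sign, by a graph automorphism (here `ε` is `1` or `-1`, which the
conclusion does not record). -/
theorem exists_eq_smul_autMap (hG : IsKConnected G 3) (hA : A ∈ o.cycleIsometryGroup) :
    ∃ (φ : G ≃g G) (ε : ℝ), ∀ f, A f = ε • o.autMap φ f := by
  obtain ⟨σ, s, hs, h⟩ := exists_signedPerm A hA.1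
  have hs0 (e) : s e ≠ 0 := fun h0 => by simpa [h0] using hs e
  choose τ ε hε hτ using o.exists_smul_grad_single hG hA hs h
  have hε0 (v) : ε v ≠ 0 := fun h0 => by simpa [h0] using hε v
  have hrel (v : V) (e : G.edgeSet) :
      s e * o.incidence v e = ε v * o.incidence (τ v) (σ e) := by
    rw [← grad_single, ← h, hτ, PiLp.smul_apply, grad_single, smul_eq_mul]
  have hmem (v : V) (e : G.edgeSet) : τ v ∈ (σ e : Sym2 V) ↔ v ∈ (e : Sym2 V) := by
    have h0 := hrel v e
    rw [← o.incidence_ne_zero_iff, ← o.incidence_ne_zero_iff, not_iff_not]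
    constructor
    · intro h1
      rw [h1, mul_zero] at h0
      exact (mul_eq_zero_iff_left (hs0 e)).1 h0
    · intro h1
      rw [h1, mul_zero] at h0
      exact (mul_eq_zero_iff_left (hε0 v)).1 h0.symm
  have hinj : Function.Injective τ := fun a b hab => by
    by_contra hne
    obtain ⟨e, ha, hb⟩ := hG.exists_edge_mem_notMem hne
    rw [← hmem, ← hab, hmem] at hb
    exact hb ha
  have hends {a b : V} (hab : a ≠ b) {e : G.edgeSet} (ha : a ∈ (e : Sym2 V))
      (hb : b ∈ (e : Sym2 V)) : (σ e : Sym2 V) = s(τ a, τ b) :=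
    (Sym2.mem_and_mem_iff (hinj.ne hab)).1 ⟨(hmem a e).2 ha, (hmem b e).2 hb⟩
  let φ : G ≃g G :=
    { toEquiv := Equiv.ofBijective τ (Finite.injective_iff_bijective.1 hinj)
      map_rel_iff' := by
        intro a b
        change G.Adj (τ a) (τ b) ↔ G.Adj a b
        constructor
        · intro hab
          obtain ⟨e, he⟩ := σ.surjective ⟨s(τ a, τ b), hab⟩
          have he' : (σ e : Sym2 V) = s(τ a, τ b) := congrArg Subtype.val he
          have ha : a ∈ (e : Sym2 V) := by
            rw [← hmem, he']; exact Sym2.mem_mk_left _ _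
          have hb : b ∈ (e : Sym2 V) := by
            rw [← hmem, he']; exact Sym2.mem_mk_right _ _
          have h1 : (e : Sym2 V) = s(a, b) :=
            (Sym2.mem_and_mem_iff fun hne => hab.ne (congrArg τ hne)).1 ⟨ha, hb⟩
          have h2 := e.2
          rwa [h1] at h2
        · intro hab
          have h1 := (σ ⟨s(a, b), hab⟩).2
          rwa [hends hab.ne (Sym2.mem_mk_left a b) (Sym2.mem_mk_right a b)] at h1 }
  have hφ (v) : φ v = τ v := rfl
  have hσ (e) : σ e = φ.mapEdgeSet e := by
    apply Subtype.ext
    rw [hends (o.tail_ne_head e) (o.tail_mem e) (o.head_mem e)]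
    change _ = Sym2.map φ (e : Sym2 V)
    rw [o.ends e]
    rfl
  obtain ⟨v₀⟩ : Nonempty V := Fintype.card_pos_iff.1 (by have := hG.1; omega)
  -- The two ends of an edge have opposite incidences with it, before and after `A`, so their stars
  -- are mapped with the same sign.
  have hconst (v : V) : ε v = ε v₀ := by
    refine hG.eq_of_forall_adj (S := ∅) (by simp) (fun a b hab _ _ => ?_) (by simp) (by simp)
    have ha : a ∈ s(a, b) := Sym2.mem_mk_left a b
    have hb : b ∈ s(a, b) := Sym2.mem_mk_right a b
    have h1 := hrel a ⟨s(a, b), hab⟩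
    have h2 := hrel b ⟨s(a, b), hab⟩
    have h3 := o.incidence_eq_neg hab.ne (e := ⟨s(a, b), hab⟩) ha hb
    have h4 := o.incidence_eq_neg (hinj.ne hab.ne) ((hmem a ⟨s(a, b), hab⟩).2 ha)
      ((hmem b ⟨s(a, b), hab⟩).2 hb)
    have h5 := o.incidence_ne_zero_iff.2 ((hmem b ⟨s(a, b), hab⟩).2 hb)
    apply mul_right_cancel₀ h5
    rw [h3, h4] at h1
    linarith
  refine ⟨φ, ε v₀, fun f => ?_⟩
  ext e'
  obtain ⟨e, rfl⟩ := σ.surjective e'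
  have h1 := hrel (o.head e) e
  rw [← hφ, hσ, incidence_map, hconst, show o.incidence (o.head e) e = 1 by simp [incidence]] at h1
  rw [h, PiLp.smul_apply, hσ, autMap_apply_map, smul_eq_mul]
  linear_combination f e * h1

end Orientation

/-! ### Invariant projections -/

namespace Orientation

variable {V : Type*} [DecidableEq V] {G : SimpleGraph V} (o : Orientation G) [Fintype G.edgeSet]

/-- The operator induced by an automorphism, as an invertible operator of the edge space. -/
def autEquiv (φ : G ≃g G) : EdgeSpace G ≃ₗ[ℝ] EdgeSpace G :=
  LinearEquiv.ofLinearMap (o.autRep φ) (o.autRep φ⁻¹)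
    (by rw [← Module.End.mul_eq_comp, ← map_mul, mul_inv_cancel, map_one]; rfl)
    (by rw [← Module.End.mul_eq_comp, ← map_mul, inv_mul_cancel, map_one]; rfl)

theorem autEquiv_mem_cycleIsometryGroup (φ : G ≃g G) : o.autEquiv φ ∈ o.cycleIsometryGroup := by
  refine ⟨fun f => ?_, fun f hf => o.autRep_mem_cycleSpace φ hf⟩
  rw [PiLp.norm_eq_of_L1, PiLp.norm_eq_of_L1, ← Equiv.sum_comp φ.mapEdgeSet]
  refine Finset.sum_congr rfl fun e _ => ?_
  change ‖o.autMap φ f (φ.mapEdgeSet e)‖ = ‖f e‖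
  rw [autMap_apply_map, norm_mul]
  have h : ‖o.sign φ e‖ = 1 := by unfold sign; split_ifs <;> simp
  rw [h, one_mul]

theorem isInvariantProjection_starProjection :
    o.IsInvariantProjection (o.cycleSpace.starProjection : EdgeSpace G →ₗ[ℝ] EdgeSpace G) :=
  ⟨⟨fun f => o.cycleSpace.starProjection_apply_mem f,
    fun _ hf => Submodule.starProjection_eq_self_iff.2 hf⟩,
    fun A hA => starProjection_comm_of_invariant o.cycleSpace A hA.2
      fun _ hf => o.cutSpace_of_mem_cycleIsometryGroup hA hf⟩

theorem inner_cutRep (φ : G ≃g G) (x y : o.cutSpace) :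
    inner ℝ (o.cutRep φ x) (o.cutRep φ y) = inner ℝ x y :=
  o.inner_autMap φ x y

theorem IsInvariantProjection.eq_starProjection {P : EdgeSpace G →ₗ[ℝ] EdgeSpace G}
    (hP : o.IsInvariantProjection P)
    (h : ∀ T : o.cutRep.IntertwiningMap o.cycleRep, T = 0) :
    P = (o.cycleSpace.starProjection : EdgeSpace G →ₗ[ℝ] EdgeSpace G) := by
  let T : o.cutRep.IntertwiningMap o.cycleRep :=
    ((P ∘ₗ o.cutSpace.subtype).codRestrict o.cycleSpace fun _ => hP.1.map_mem _
      ).intertwiningMap_of_isIntertwiningMap o.cutRep o.cycleRep fun φ f =>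
        Subtype.ext (hP.2 _ (o.autEquiv_mem_cycleIsometryGroup φ) f)
  have hT (f : EdgeSpace G) (hf : f ∈ o.cutSpace) : P f = 0 :=
    congrArg Subtype.val (show T ⟨f, hf⟩ = 0 by rw [h T]; rfl)
  refine LinearMap.ext fun f => ?_
  have h1 := hT _ (o.cycleSpace.sub_starProjection_mem_orthogonal f)
  rw [map_sub, hP.1.map_id _ (o.cycleSpace.starProjection_apply_mem f), sub_eq_zero] at h1
  exact h1

/-- An `Aut(G)`-intertwining map of the cut space into the cycle space commutes with all of `Cy(G)`,
because the two groups differ only by signs; added to the orthogonal projection it gives a second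
invariant projection. -/
theorem exists_isInvariantProjection_ne [Fintype V] (hG : IsKConnected G 3)
    {T : o.cutRep.IntertwiningMap o.cycleRep} (hT : T ≠ 0) :
    ∃ P, o.IsInvariantProjection P ∧
      P ≠ (o.cycleSpace.starProjection : EdgeSpace G →ₗ[ℝ] EdgeSpace G) := by
  have hP₀ := o.isInvariantProjection_starProjection
  let π : EdgeSpace G →ₗ[ℝ] o.cutSpace := o.cutSpace.orthogonalProjectionOnto.toLinearMap
  have hπ (φ : G ≃g G) (f : EdgeSpace G) : π (o.autMap φ f) = o.cutRep φ (π f) :=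
    Subtype.ext <| starProjection_comm_of_invariant o.cutSpace (o.autMap φ)
      (fun f hf => o.autRep_mem_cutSpace φ hf)
      (fun f hf => by
        rw [cutSpace, Submodule.orthogonal_orthogonal] at hf ⊢
        exact o.autRep_mem_cycleSpace φ hf) f
  have hTφ (φ : G ≃g G) (f : EdgeSpace G) :
      (T (π (o.autMap φ f)) : EdgeSpace G) = o.autMap φ (T (π f)) := by
    rw [hπ, T.isIntertwining]; rfl
  refine ⟨o.cycleSpace.starProjection + o.cycleSpace.subtype ∘ₗ T.toLinearMap ∘ₗ π,
    ⟨⟨fun f => o.cycleSpace.add_mem (hP₀.1.map_mem f) (T (π f)).2, fun f hf => ?_⟩,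
      fun A hA f => ?_⟩, fun h => hT <| DFunLike.ext _ _ fun f => ?_⟩
  · have h0 : π f = 0 := by
      refine Submodule.orthogonalProjectionOnto_apply_of_mem_orthogonal ?_
      rwa [cutSpace, Submodule.orthogonal_orthogonal]
    change _ + (T (π f) : EdgeSpace G) = f
    rw [h0, map_zero, Submodule.coe_zero, add_zero]
    exact hP₀.1.map_id f hf
  · obtain ⟨φ, ε, hφ⟩ := o.exists_eq_smul_autMap hG hA
    have h1 := hP₀.2 A hA f
    rw [LinearMap.add_apply, LinearMap.add_apply, map_add, h1]
    congr 1
    change (T (π (A f)) : EdgeSpace G) = A (T (π f))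
    rw [hφ, hφ, map_smul, map_smul, Submodule.coe_smul, hTφ]
  · have h1 := LinearMap.congr_fun h f
    rw [LinearMap.add_apply, add_eq_left] at h1
    have h2 : π f = f := Submodule.orthogonalProjectionOnto_mem_subspace_eq_self f
    refine Subtype.ext ?_
    rw [← h2]
    exact h1

end Orientation

end GraphCycleSpace

end

theorem corollaryC {V : Type*} [Fintype V] [DecidableEq V] (G : SimpleGraph V)
    [Fintype G.edgeSet] (hG : GraphCycleSpace.IsKConnected G 3)
    (o : GraphCycleSpace.Orientation G) :
    (∃! P : GraphCycleSpace.EdgeSpace G →ₗ[ℝ] GraphCycleSpace.EdgeSpace G,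
        o.IsInvariantProjection P) ↔
      ¬ GraphCycleSpace.HaveEquivalentRestrictions o.cycleRep o.cutRep := by
  rw [GraphCycleSpace.haveEquivalentRestrictions_iff _ _ o.inner_cutRep]
  constructor
  · rintro ⟨P, -, hP⟩ ⟨T, hT⟩
    obtain ⟨Q, hQ, hne⟩ := o.exists_isInvariantProjection_ne hG hT
    exact hne ((hP Q hQ).trans (hP _ o.isInvariantProjection_starProjection).symm)
  · intro h
    push Not at h
    exact ⟨_, o.isInvariantProjection_starProjection, fun P hP => hP.eq_starProjection o h⟩
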